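/- Let $(M,g)$ be an oriented semi-Riemannian $4$-manifold with Levi-Civita connection $\nabla$, and let $k$, $t$ be two smooth vector fields on $M$ that are everywhere linearly independent and such that $g$ is positive definite on $\mathcal H:=\mathcal V^\perp$, where $\mathcal V:=\mathrm{span}(k,t)$. Give $\mathcal H$ the orientation for which $(k,t,x,y)$ is positively oriented whenever $(x,y)$ is an oriented frame of $\mathcal H$. Let $J=J_{g,k,t}$ be the almost complex structure with $Jk=t$, $Jt=-k$ and $J|_{\mathcal H}$ the unique $g$-isometric endomorphism of $\mathcal H$ with square $-1$ that respects the orientation of $\mathcal H$. For a vector field $X$ in $\mathcal V$ let $\nabla^oX:\mathcal H\to\mathcal H$ (the relative shear) be the trace-free symmetric part of $v\mapsto\pi(\nabla_vX)$, $v\in\mathcal H$, where $\pi:TM\to\mathcal H$ is the projection along $\mathcal V$. Assume that $g$ is admissible, i.e. that (a) $[k,\Gamma(\mathcal H)]\subset\Gamma(\mathcal H)$, $[t,\Gamma(\mathcal H)]\subset\Gamma(\mathcal H)$, and $J\nabla^o k=\nabla^o t$ on $\mathcal H$; (b) $t=\ell\,\nabla\tau$ for smooth functions $\tau,\ell$ on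 $M$; (c) $\nabla(g(k,t))$ and $\nabla(g(k,k))$ are sections of $\mathcal V$. Let $\iota:=g(\nabla_yk,x)-g(\nabla_xk,y)=g(k,[x,y])$ for any local oriented orthonormal frame $x,y$ of $\mathcal H$, let $G:=g(k,k)g(t,t)-g(k,t)^2$ and $k^\flat:=g(k,\cdot)$. For a smooth function $f$ on the range of $\tau$, the Kähler metric induced by $g$ and $f$ is the tensor $$g_K:=d(f(\tau)k^\flat)(\cdot,J\cdot)$$ on the region of $M$ where $$f\iota<0\quad\text{and}\quad f'G/\ell-f\,dk^\flat(k,t)<0$$ (with $f,f'$ evaluated at $\tau$). Suppose in addition that $k$ is a Killing field of $g$, that $\ell$ and $\iota$ are locally functions of $\tau$, that $g(k,t)=0$, and that $[k,t]=0$. Then for every smooth $f$ on the range of $\tau$, the field $k$ is also a Killing field of the induced Kähler metric $g_K$ on that region, i.e. $d_k(g_K(a,b))=g_K([k,a],b)+g_K(a,[k,b])$ there for all smooth local vector fields $a,b$. -/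

import Mathlib

open scoped Manifold ContDiff

section LinearAlgebra

variable {W : Type*} [AddCommGroup W] [Module ℝ W]

/-- The list of vectors `v` is a basis of `W` which is positively oriented with respect to `o`. -/
def IsPosFrame (o : Orientation ℝ W (Fin 4)) (v : Fin 4 → W) : Prop :=
  ∃ b : Module.Basis (Fin 4) ℝ W, ⇑b = v ∧ b.orientation = o

/-- The orthogonal complement of the span of `k` and `t`. -/
def horSpace (B : LinearMap.BilinForm ℝ W) (k t : W) : Submodule ℝ W :=
  B.orthogonal (Submodule.span ℝ {k, t})

theorem mem_horSpace {B : LinearMap.BilinForm ℝ W} {k t v : W} :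
    v ∈ horSpace B k t ↔ B k v = 0 ∧ B t v = 0 := by
  unfold horSpace
  rw [LinearMap.BilinForm.mem_orthogonal_iff]
  constructor
  · intro h
    exact ⟨h k (Submodule.subset_span (by simp)), h t (Submodule.subset_span (by simp))⟩
  · rintro ⟨h1, h2⟩ n hn
    obtain ⟨a, b, rfl⟩ := Submodule.mem_span_pair.1 hn
    simp [h1, h2]

/-- `B` is positive definite on the orthogonal complement of `k`, `t`. -/
def IsPosOnHor (B : LinearMap.BilinForm ℝ W) (k t : W) : Prop :=
  ∀ v ∈ horSpace B k t, v ≠ 0 → 0 < B v v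

/-- `x`, `y` is an orthonormal frame of the orthogonal complement of `k`, `t`, oriented so that
`k`, `t`, `x`, `y` is positively oriented. -/
structure IsHorFrame (B : LinearMap.BilinForm ℝ W) (o : Orientation ℝ W (Fin 4))
    (k t x y : W) : Prop where
  mem_left : x ∈ horSpace B k t
  mem_right : y ∈ horSpace B k t
  norm_left : B x x = 1
  norm_right : B y y = 1
  ortho : B x y = 0
  pos : IsPosFrame o ![k, t, x, y]

/-- The defining properties of the endomorphism `J`: it rotates `k` to `t` and `t` to `-k`, and
on the orthogonal complement of `k`, `t` it restricts to an isometric endomorphism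
with square `-1` which respects the orientation. -/
structure IsAdmissibleEndo (B : LinearMap.BilinForm ℝ W) (o : Orientation ℝ W (Fin 4))
    (k t : W) (J : W →ₗ[ℝ] W) : Prop where
  map_k : J k = t
  map_t : J t = -k
  map_hor : ∀ v ∈ horSpace B k t, J v ∈ horSpace B k t
  sq_hor : ∀ v ∈ horSpace B k t, J (J v) = -v
  isometry_hor : ∀ v ∈ horSpace B k t, ∀ w ∈ horSpace B k t, B (J v) (J w) = B v w
  pos_hor : ∀ v ∈ horSpace B k t, v ≠ 0 → IsPosFrame o ![k, t, v, J v]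

theorem isCompl_horSpace [FiniteDimensional ℝ W] {B : LinearMap.BilinForm ℝ W} {k t : W}
    (hB : ∀ v w, B v w = B w v) (hpos : IsPosOnHor B k t) :
    IsCompl (Submodule.span ℝ {k, t}) (horSpace B k t) := by
  have hr : B.IsRefl := fun v w h => by rw [hB w v, h]
  refine (LinearMap.BilinForm.isCompl_orthogonal_iff_disjoint hr).2 ?_
  rw [Submodule.disjoint_def]
  intro v hv hv'
  by_contra hne
  have h1 := hpos v hv' hne
  rw [LinearMap.BilinForm.mem_orthogonal_iff] at hv'
  exact h1.ne' (hv' v hv)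

theorem finrank_horSpace (hW : Module.finrank ℝ W = 4)
    {B : LinearMap.BilinForm ℝ W} {k t : W}
    (hB : ∀ v w, B v w = B w v) (hli : LinearIndependent ℝ ![k, t]) (hpos : IsPosOnHor B k t) :
    Module.finrank ℝ (horSpace B k t) = 2 := by
  have : FiniteDimensional ℝ W := Module.finite_of_finrank_pos (by omega)
  have h := Submodule.finrank_add_eq_of_isCompl (isCompl_horSpace hB hpos)
  have h2 := finrank_span_eq_card hli
  have h3 : Set.range ![k, t] = {k, t} := by simp [Set.pair_comm]
  rw [h3, Fintype.card_fin] at h2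
  omega

/-- Vectors `k`, `t` together with an orthonormal pair orthogonal to them form a basis. -/
theorem linearIndependent_frame [FiniteDimensional ℝ W] {B : LinearMap.BilinForm ℝ W} {k t x y : W}
    (hB : ∀ v w, B v w = B w v) (hli : LinearIndependent ℝ ![k, t])
    (hx : x ∈ horSpace B k t) (hy : y ∈ horSpace B k t)
    (hxx : B x x = 1) (hyy : B y y = 1) (hxy : B x y = 0) :
    LinearIndependent ℝ ![k, t, x, y] := by
  rw [Fintype.linearIndependent_iff]
  intro c hc
  simp only [Fin.sum_univ_four, Matrix.cons_val] at hc
  have hx' := mem_horSpace.1 hx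
  have hy' := mem_horSpace.1 hy
  have h2 : c 2 = 0 := by
    have := congrArg (fun z => B z x) hc
    simpa [hx'.1, hx'.2, hxx, hB y x, hxy] using this
  have h3 : c 3 = 0 := by
    have := congrArg (fun z => B z y) hc
    simpa [hy'.1, hy'.2, hyy, hxy] using this
  have h01 : c 0 = 0 ∧ c 1 = 0 := by
    rw [h2, h3] at hc
    exact LinearIndependent.pair_iff.1 hli _ _ (by simpa using hc)
  intro i
  fin_cases i
  exacts [h01.1, h01.2, h2, h3]

theorem exists_isHorFrame (hW : Module.finrank ℝ W = 4)
    {B : LinearMap.BilinForm ℝ W} {k t : W} (o : Orientation ℝ W (Fin 4))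
    (hB : ∀ v w, B v w = B w v) (hli : LinearIndependent ℝ ![k, t]) (hpos : IsPosOnHor B k t) :
    ∃ x y, IsHorFrame B o k t x y := by
  have : FiniteDimensional ℝ W := Module.finite_of_finrank_pos (by omega)
  have key : ∃ x y : W, x ∈ horSpace B k t ∧ y ∈ horSpace B k t ∧ B x x = 1 ∧ B y y = 1 ∧
      B x y = 0 := by
    let e := Module.finBasisOfFinrankEq ℝ _ (finrank_horSpace hW hB hli hpos)
    have hnorm : ∀ v ∈ horSpace B k t, v ≠ 0 →
        ∃ c : ℝ, c ≠ 0 ∧ B (c • v) (c • v) = 1 := by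
      intro v hv hne
      have h := hpos v hv hne
      have hs := Real.sqrt_pos.2 h
      refine ⟨(Real.sqrt (B v v))⁻¹, inv_ne_zero hs.ne', ?_⟩
      have h2 := Real.mul_self_sqrt h.le
      simp only [map_smul, LinearMap.smul_apply, smul_eq_mul]
      field_simp
      nlinarith
    have hx0 : (e 0 : W) ≠ 0 := by simpa using e.ne_zero 0
    obtain ⟨c, hc, hcx⟩ := hnorm _ (e 0).2 hx0
    set x : W := c • (e 0 : W) with hx
    have hxm : x ∈ horSpace B k t := Submodule.smul_mem _ _ (e 0).2
    let y' : W := (e 1 : W) - B x (e 1) • x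
    have hym : y' ∈ horSpace B k t := Submodule.sub_mem _ (e 1).2 (Submodule.smul_mem _ _ hxm)
    have hy0 : y' ≠ 0 := by
      intro h
      have hli2 := e.linearIndependent
      rw [Fintype.linearIndependent_iff] at hli2
      have := hli2 ![-(B x (e 1) * c), 1] (by
        apply Subtype.ext
        simp only [Fin.sum_univ_two, Matrix.cons_val, Submodule.coe_add, Submodule.coe_smul,
          Submodule.coe_zero]
        rw [← h]
        simp only [y', hx, smul_smul]
        module) 1
      simp at this
    obtain ⟨d, -, hdy⟩ := hnorm _ hym hy0
    refine ⟨x, d • y', hxm, Submodule.smul_mem _ _ hym, hcx, hdy, ?_⟩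
    simp [y', hcx]
  obtain ⟨x, y, hx, hy, hxx, hyy, hxy⟩ := key
  have hb := linearIndependent_frame hB hli hx hy hxx hyy hxy
  let b := basisOfLinearIndependentOfCardEqFinrank hb (by simp [hW])
  rcases b.orientation_eq_or_eq_neg o with h | h
  · exact ⟨x, y, hx, hy, hxx, hyy, hxy, b, by simp [b], h.symm⟩
  · refine ⟨x, -y, hx, Submodule.neg_mem _ hy, hxx, by simpa using hyy, by simpa using hxy,
      b.unitsSMul ![1, 1, 1, -1], ?_, ?_⟩
    · ext i
      fin_cases i <;> simp [b, Module.Basis.unitsSMul_apply]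
    · rw [Module.Basis.orientation_unitsSMul, h]
      simp [Fin.prod_univ_four]

/-- The orthogonal complement is spanned by any oriented orthonormal frame. -/
theorem IsHorFrame.expand {B : LinearMap.BilinForm ℝ W} {o : Orientation ℝ W (Fin 4)}
    {k t x y : W} (hB : ∀ v w, B v w = B w v) (hpos : IsPosOnHor B k t)
    (h : IsHorFrame B o k t x y)
    {v : W} (hv : v ∈ horSpace B k t) : v = B v x • x + B v y • y := by
  have : FiniteDimensional ℝ W := by
    obtain ⟨b, -, -⟩ := h.pos
    exact b.finiteDimensional_of_finite
  obtain ⟨b, hb, -⟩ := h.pos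
  have hs := b.sum_repr v
  rw [hb] at hs
  simp only [Fin.sum_univ_four, Matrix.cons_val] at hs
  set p := b.repr v 0
  set q := b.repr v 1
  set r := b.repr v 2
  set s := b.repr v 3
  have hx := mem_horSpace.1 h.mem_left
  have hy := mem_horSpace.1 h.mem_right
  have hvx : B v x = r := by
    rw [← hs]; simp [hx.1, hx.2, h.norm_left, hB y x, h.ortho]
  have hvy : B v y = s := by
    rw [← hs]; simp [hy.1, hy.2, h.norm_right, h.ortho]
  have h0 : p • k + q • t = 0 := by
    have hm : p • k + q • t ∈ Submodule.span ℝ {k, t} := Submodule.mem_span_pair.2 ⟨p, q, rfl⟩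
    have hm' : p • k + q • t ∈ horSpace B k t := by
      have : p • k + q • t = v - (r • x + s • y) := by rw [← hs]; abel
      rw [this]
      exact Submodule.sub_mem _ hv (Submodule.add_mem _ (Submodule.smul_mem _ _ h.mem_left)
        (Submodule.smul_mem _ _ h.mem_right))
    exact Submodule.disjoint_def.1 (isCompl_horSpace hB hpos).disjoint _ hm hm'
  rw [hvx, hvy]
  rw [h0, zero_add] at hs
  exact hs.symm

/-- Rotating an oriented frame: with `v = a x + b y`, `w = c x + d y` the list `k, t, v, w` is
positively oriented if and only if `a d - b c > 0`. -/
theorem isPosFrame_iff {o : Orientation ℝ W (Fin 4)} {k t x y : W}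
    (h : IsPosFrame o ![k, t, x, y]) (a b c d : ℝ) :
    IsPosFrame o ![k, t, a • x + b • y, c • x + d • y] ↔ 0 < a * d - b * c := by
  obtain ⟨e, he, ho⟩ := h
  have hdet : e.det ![k, t, a • x + b • y, c • x + d • y] = a * d - b * c := by
    have hk : k = e 0 := by rw [he]; rfl
    have ht : t = e 1 := by rw [he]; rfl
    have hx : x = e 2 := by rw [he]; rfl
    have hy : y = e 3 := by rw [he]; rfl
    rw [Module.Basis.det_apply]
    have : e.toMatrix ![k, t, a • x + b • y, c • x + d • y] =
        !![1, 0, 0, 0; 0, 1, 0, 0; 0, 0, a, c; 0, 0, b, d] := by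
      ext i j
      rw [hk, ht, hx, hy]
      fin_cases i <;> fin_cases j <;> simp [Module.Basis.toMatrix_apply]
    rw [this]
    simp [Matrix.det_succ_row_zero, Fin.sum_univ_succ]
    ring
  constructor
  · rintro ⟨e', he', ho'⟩
    rw [← hdet, ← he', ← Module.Basis.orientation_eq_iff_det_pos, ho, ho']
  · intro hp
    have hu : IsUnit (e.det ![k, t, a • x + b • y, c • x + d • y]) := by
      rw [hdet]; exact hp.ne'.isUnit
    obtain ⟨hl, hs⟩ := (Module.Basis.is_basis_iff_det e).2 hu
    refine ⟨Module.Basis.mk hl hs.ge, Module.Basis.coe_mk _ _, ?_⟩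
    rw [← ho, eq_comm, Module.Basis.orientation_eq_iff_det_pos, Module.Basis.coe_mk, hdet]
    exact hp

/-- An admissible endomorphism maps the first vector of an oriented orthonormal frame to the
second one. -/
theorem IsAdmissibleEndo.map_left {B : LinearMap.BilinForm ℝ W} {o : Orientation ℝ W (Fin 4)}
    {k t x y : W} {J : W →ₗ[ℝ] W} (hB : ∀ v w, B v w = B w v) (hpos : IsPosOnHor B k t)
    (hJ : IsAdmissibleEndo B o k t J) (h : IsHorFrame B o k t x y) : J x = y := by
  have hm := hJ.map_hor x h.mem_left
  have hex := h.expand hB hpos hm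
  have h0 : B (J x) x = 0 := by
    have h1 := hJ.isometry_hor _ hm _ h.mem_left
    rw [hJ.sq_hor x h.mem_left] at h1
    simp only [map_neg, LinearMap.neg_apply] at h1
    rw [hB x (J x)] at h1
    linarith
  rw [h0, zero_smul, zero_add] at hex
  have h1 : B (J x) y * B (J x) y = 1 := by
    have h2 := hJ.isometry_hor _ h.mem_left _ h.mem_left
    rw [h.norm_left] at h2
    rw [← h2]
    conv_rhs => rw [hex]
    simp [h.norm_right]
  have hx0 : x ≠ 0 := by
    rintro rfl
    simpa using h.norm_left
  have h2 : 0 < B (J x) y := by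
    have h3 := hJ.pos_hor x h.mem_left hx0
    have h4 := (isPosFrame_iff h.pos 1 0 0 (B (J x) y)).1 (by
      simp only [one_smul, zero_smul, add_zero, zero_add]
      rwa [← hex])
    simpa using h4
  have h3 : B (J x) y = 1 := by nlinarith
  rw [hex, h3, one_smul]

theorem IsHorFrame.isAdmissibleEndo {B : LinearMap.BilinForm ℝ W} {o : Orientation ℝ W (Fin 4)}
    {k t x y : W} (hB : ∀ v w, B v w = B w v) (hpos : IsPosOnHor B k t)
    (h : IsHorFrame B o k t x y) : ∃ J, IsAdmissibleEndo B o k t J := by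
  obtain ⟨b, hb, hbo⟩ := id h.pos
  let J : W →ₗ[ℝ] W := b.constr ℝ ![t, -k, y, -x]
  have hJ : ∀ i, J (![k, t, x, y] i) = ![t, -k, y, -x] i := by
    intro i
    rw [← hb]
    exact b.constr_basis ℝ _ i
  have hJk : J k = t := hJ 0
  have hJt : J t = -k := hJ 1
  have hJx : J x = y := hJ 2
  have hJy : J y = -x := hJ 3
  have hJv : ∀ v ∈ horSpace B k t, J v = (-B v y) • x + B v x • y := by
    intro v hv
    conv_lhs => rw [h.expand hB hpos hv]
    simp only [map_add, map_smul, hJx, hJy]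
    module
  refine ⟨J, hJk, hJt, ?_, ?_, ?_, ?_⟩
  · intro v hv
    rw [hJv v hv]
    exact Submodule.add_mem _ (Submodule.smul_mem _ _ h.mem_left)
      (Submodule.smul_mem _ _ h.mem_right)
  · intro v hv
    rw [hJv v hv]
    conv_rhs => rw [h.expand hB hpos hv]
    simp only [map_add, map_smul, hJx, hJy]
    module
  · intro v hv w hw
    have e2 : B v w = B v x * B w x + B v y * B w y := by
      conv_lhs => rw [h.expand hB hpos hw]
      simp only [map_add, map_smul, smul_eq_mul]
      ring
    rw [hJv v hv, hJv w hw, e2]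
    simp only [map_add, map_smul, LinearMap.add_apply, LinearMap.smul_apply, smul_eq_mul,
      h.norm_left, h.norm_right, h.ortho, hB y x]
    ring
  · intro v hv hne
    have e2 : B v v = B v x * B v x + B v y * B v y := by
      conv_lhs => rw [h.expand hB hpos hv]
      simp only [map_add, map_smul, smul_eq_mul, LinearMap.add_apply, LinearMap.smul_apply,
        h.norm_left, h.norm_right, h.ortho, hB y x]
      ring
    have hp := hpos v hv hne
    have := (isPosFrame_iff h.pos (B v x) (B v y) (-B v y) (B v x)).2 (by nlinarith)
    rwa [← h.expand hB hpos hv, ← hJv v hv] at this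

theorem existsUnique_isAdmissibleEndo (hW : Module.finrank ℝ W = 4)
    {B : LinearMap.BilinForm ℝ W} {k t : W} (o : Orientation ℝ W (Fin 4))
    (hB : ∀ v w, B v w = B w v) (hli : LinearIndependent ℝ ![k, t]) (hpos : IsPosOnHor B k t) :
    ∃! J, IsAdmissibleEndo B o k t J := by
  obtain ⟨x, y, h⟩ := exists_isHorFrame hW o hB hli hpos
  obtain ⟨J, hJ⟩ := h.isAdmissibleEndo hB hpos
  refine ⟨J, hJ, fun J' hJ' => ?_⟩
  obtain ⟨b, hb, -⟩ := id h.pos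
  have hx := hJ.map_left hB hpos h
  have hx' := hJ'.map_left hB hpos h
  have hy : J y = -x := by rw [← hx, hJ.sq_hor x h.mem_left]
  have hy' : J' y = -x := by rw [← hx', hJ'.sq_hor x h.mem_left]
  refine b.ext fun i => ?_
  rw [hb]
  fin_cases i
  · exact hJ'.map_k.trans hJ.map_k.symm
  · exact hJ'.map_t.trans hJ.map_t.symm
  · exact hx'.trans hx.symm
  · exact hy'.trans hy.symm

/-- Skew expressions do not depend on the oriented orthonormal frame. -/
theorem IsHorFrame.skew_eq {B : LinearMap.BilinForm ℝ W} {o : Orientation ℝ W (Fin 4)}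
    {k t x y x' y' : W} (hB : ∀ v w, B v w = B w v) (hpos : IsPosOnHor B k t)
    (h : IsHorFrame B o k t x y) (h' : IsHorFrame B o k t x' y') (D : W →ₗ[ℝ] W) :
    B (D y') x' - B (D x') y' = B (D y) x - B (D x) y := by
  obtain ⟨J, hJ⟩ := h.isAdmissibleEndo hB hpos
  have hx := hJ.map_left hB hpos h
  have hx' := hJ.map_left hB hpos h'
  have hy : J y = -x := by rw [← hx, hJ.sq_hor x h.mem_left]
  obtain ⟨a, b, hab⟩ : ∃ a b : ℝ, x' = a • x + b • y := ⟨_, _, h.expand hB hpos h'.mem_left⟩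
  have hy'e : y' = a • y - b • x := by
    rw [← hx', hab]
    simp only [map_add, map_smul, hx, hy]
    module
  have hn := h'.norm_left
  rw [hab] at hn
  simp only [map_add, map_smul, LinearMap.add_apply, LinearMap.smul_apply, smul_eq_mul,
    h.norm_left, h.norm_right, h.ortho, hB y x] at hn
  rw [hab, hy'e]
  simp only [map_add, map_sub, map_smul, LinearMap.add_apply, LinearMap.smul_apply,
    LinearMap.sub_apply, smul_eq_mul]
  linear_combination (B (D y) x - B (D x) y) * hn

end LinearAlgebra

section Geometry

set_option linter.unusedSectionVars false

open Bundle VectorField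

variable {M : Type*} [TopologicalSpace M] [ChartedSpace (EuclideanSpace ℝ (Fin 4)) M]
  [IsManifold (𝓡 4) ∞ M]

/-- A field of tangent vectors which is smooth at the point `p`. -/
def SmoothFieldAt (X : (q : M) → TangentSpace (𝓡 4) q) (p : M) : Prop :=
  ContMDiffAt (𝓡 4) (𝓡 4).tangent ∞ (fun q => (⟨q, X q⟩ : TangentBundle (𝓡 4) M)) p

/-- A field of tangent vectors which is differentiable at the point `p`. -/
abbrev DiffFieldAt (X : (q : M) → TangentSpace (𝓡 4) q) (p : M) : Prop :=
  MDifferentiableAt (𝓡 4) (𝓡 4).tangent (fun q => (⟨q, X q⟩ : TangentBundle (𝓡 4) M)) p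

/-- The directional derivative `d_v φ` of a real function. -/
noncomputable def dirDeriv (φ : M → ℝ) (p : M) (v : TangentSpace (𝓡 4) p) : ℝ :=
  mvfderiv (𝓡 4) φ p v

/-- `h` is locally a function of `τ`. -/
def IsLocallyFunctionOf (h τ : M → ℝ) : Prop :=
  ∀ p : M, ∃ φ : ℝ → ℝ, ∀ᶠ q in nhds p, h q = φ (τ q)

variable (M) in
/-- An orientation of `M`: an orientation of every tangent space, such that smooth
local frames which are positively oriented at a point remain so nearby. -/
structure ManifoldOrientation where
  toFun (p : M) : Orientation ℝ (TangentSpace (𝓡 4) p) (Fin 4)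
  locally_const (p : M) (X : Fin 4 → (q : M) → TangentSpace (𝓡 4) q) :
    (∀ i, SmoothFieldAt (X i) p) → IsPosFrame (toFun p) (fun i => X i p) →
      ∀ᶠ q in nhds p, IsPosFrame (toFun q) (fun i => X i q)

/-- The exterior derivative of a one-form, by the formula
`dα(V, W) = V (α W) - W (α V) - α [V, W]`, applied to local extensions of the two vectors (the value does not depend on the choice of the
extensions, see `exteriorDeriv_apply`). -/
noncomputable def exteriorDeriv (α : (p : M) → TangentSpace (𝓡 4) p →ₗ[ℝ] ℝ) (p : M)
    (v w : TangentSpace (𝓡 4) p) : ℝ :=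
  let V := FiberBundle.extend (EuclideanSpace ℝ (Fin 4)) v
  let W := FiberBundle.extend (EuclideanSpace ℝ (Fin 4)) w
  dirDeriv (fun q => α q (W q)) p v - dirDeriv (fun q => α q (V q)) p w -
    α p (mlieBracket (𝓡 4) V W p)

/-- The vector field `k` is Killing on the set `U` for the symmetric 2-tensor field `h`:
`d_k (h(a,b)) = h([k,a],b) + h(a,[k,b])` at the points of `U`. -/
def IsKillingOn (h : (p : M) → TangentSpace (𝓡 4) p → TangentSpace (𝓡 4) p → ℝ)
    (k : (p : M) → TangentSpace (𝓡 4) p) (U : Set M) : Prop :=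
  ∀ p ∈ U, ∀ a b : (q : M) → TangentSpace (𝓡 4) q, SmoothFieldAt a p → SmoothFieldAt b p →
    dirDeriv (fun q => h q (a q) (b q)) p (k p) =
      h p (mlieBracket (𝓡 4) k a p) (b p) + h p (a p) (mlieBracket (𝓡 4) k b p)

variable (M) in
/-- Smooth vector fields. -/
abbrev SmoothVectorField :=
  ContMDiffSection (𝓡 4) (EuclideanSpace ℝ (Fin 4)) ∞ (fun p : M => TangentSpace (𝓡 4) p)

variable (M) in
/-- A smooth semi-Riemannian metric: a smooth field of nondegenerate symmetric bilinear forms. -/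
structure SemiRiemannianMetric where
  toFun (p : M) : TangentSpace (𝓡 4) p →L[ℝ] TangentSpace (𝓡 4) p →L[ℝ] ℝ
  symm (p : M) (v w : TangentSpace (𝓡 4) p) : toFun p v w = toFun p w v
  nondegenerate (p : M) (v : TangentSpace (𝓡 4) p) : (∀ w, toFun p v w = 0) → v = 0
  contMDiff : ContMDiff (𝓡 4)
    ((𝓡 4).prod 𝓘(ℝ, EuclideanSpace ℝ (Fin 4) →L[ℝ] EuclideanSpace ℝ (Fin 4) →L[ℝ] ℝ)) ∞
    (fun p => TotalSpace.mk'
      (EuclideanSpace ℝ (Fin 4) →L[ℝ] EuclideanSpace ℝ (Fin 4) →L[ℝ] ℝ) p (toFun p))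

instance tangentSpace_finiteDimensional (p : M) : FiniteDimensional ℝ (TangentSpace (𝓡 4) p) :=
  inferInstanceAs (FiniteDimensional ℝ (EuclideanSpace ℝ (Fin 4)))

theorem finrank_tangentSpace (p : M) : Module.finrank ℝ (TangentSpace (𝓡 4) p) = 4 :=
  (finrank_euclideanSpace_fin : Module.finrank ℝ (EuclideanSpace ℝ (Fin 4)) = 4)

theorem dirDeriv_add {φ ψ : M → ℝ} {p : M} (hφ : MDifferentiableAt (𝓡 4) 𝓘(ℝ, ℝ) φ p)
    (hψ : MDifferentiableAt (𝓡 4) 𝓘(ℝ, ℝ) ψ p) (v : TangentSpace (𝓡 4) p) :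
    dirDeriv (fun q => φ q + ψ q) p v = dirDeriv φ p v + dirDeriv ψ p v := by
  unfold dirDeriv
  rw [mvfderiv_fun_add hφ hψ]
  rfl

theorem dirDeriv_mul {φ ψ : M → ℝ} {p : M} (hφ : MDifferentiableAt (𝓡 4) 𝓘(ℝ, ℝ) φ p)
    (hψ : MDifferentiableAt (𝓡 4) 𝓘(ℝ, ℝ) ψ p) (v : TangentSpace (𝓡 4) p) :
    dirDeriv (fun q => φ q * ψ q) p v = φ p * dirDeriv ψ p v + dirDeriv φ p v * ψ p := by
  unfold dirDeriv
  rw [mvfderiv_fun_mul hφ hψ]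
  simp [mul_comm]

theorem exteriorDeriv_apply {α : (p : M) → TangentSpace (𝓡 4) p →ₗ[ℝ] ℝ} {p : M}
    (hα : ∀ V : (q : M) → TangentSpace (𝓡 4) q, DiffFieldAt V p →
      MDifferentiableAt (𝓡 4) 𝓘(ℝ, ℝ) (fun q => α q (V q)) p)
    {V W : (q : M) → TangentSpace (𝓡 4) q} (hV : DiffFieldAt V p) (hW : DiffFieldAt W p) :
    exteriorDeriv α p (V p) (W p) =
      dirDeriv (fun q => α q (W q)) p (V p) - dirDeriv (fun q => α q (V q)) p (W p) -
        α p (mlieBracket (𝓡 4) V W p) := by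
  let Φ : ((q : M) → TangentSpace (𝓡 4) q) → ((q : M) → TangentSpace (𝓡 4) q) → ℝ :=
    fun V W => dirDeriv (fun q => α q (W q)) p (V p) - dirDeriv (fun q => α q (V q)) p (W p) -
      α p (mlieBracket (𝓡 4) V W p)
  have h1 : ∀ W, DiffFieldAt W p →
      TensorialAt (𝓡 4) (EuclideanSpace ℝ (Fin 4)) (fun V => Φ V W) p := fun W hW =>
    { smul := fun {f V} hf hV => by
        simp only [Φ, mlieBracket_smul_left hf hV, Pi.smul_apply', map_smul, map_add, smul_eq_mul]
        rw [dirDeriv_mul hf (hα V hV)]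
        simp only [dirDeriv, map_smul, smul_eq_mul]
        ring
      add := fun {V V'} hV hV' => by
        simp only [Φ, mlieBracket_add_left hV hV', Pi.add_apply, map_add]
        rw [dirDeriv_add (hα V hV) (hα V' hV')]
        simp only [dirDeriv, map_add]
        ring }
  have h2 : ∀ V, DiffFieldAt V p →
      TensorialAt (𝓡 4) (EuclideanSpace ℝ (Fin 4)) (Φ V) p := fun V hV =>
    { smul := fun {f W} hf hW => by
        simp only [Φ, mlieBracket_smul_right hf hW, Pi.smul_apply', map_smul, map_add, smul_eq_mul]
        rw [dirDeriv_mul hf (hα W hW)]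
        simp only [dirDeriv, map_smul, smul_eq_mul]
        ring
      add := fun {W W'} hW hW' => by
        simp only [Φ, mlieBracket_add_right hW hW', Pi.add_apply, map_add]
        rw [dirDeriv_add (hα W hW) (hα W' hW')]
        simp only [dirDeriv, map_add]
        ring }
  have h := TensorialAt.mkHom₂_apply h1 h2 hV hW
  rw [TensorialAt.mkHom₂_apply_eq_extend] at h
  change _ = Φ V W
  rw [← h]
  simp [exteriorDeriv, Φ]

namespace SemiRiemannianMetric

variable (g : SemiRiemannianMetric M)

/-- The metric on a tangent space as a bilinear form. -/
noncomputable def form (p : M) : LinearMap.BilinForm ℝ (TangentSpace (𝓡 4) p) :=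
  LinearMap.mk₂ ℝ (fun v w => g.toFun p v w) (by simp) (by simp) (by simp) (by simp)

theorem form_symm (p : M) (v w : TangentSpace (𝓡 4) p) : g.form p v w = g.form p w v :=
  g.symm p v w

theorem form_nondegenerate (p : M) : (g.form p).Nondegenerate :=
  ⟨fun v h => g.nondegenerate p v h, fun v h => g.nondegenerate p v fun w => by
    rw [g.symm]; exact h w⟩

theorem mdifferentiableAt_inner {V W : (p : M) → TangentSpace (𝓡 4) p} {p : M}
    (hV : DiffFieldAt V p) (hW : DiffFieldAt W p) :
    MDifferentiableAt (𝓡 4) 𝓘(ℝ, ℝ) (fun q => g.form q (V q) (W q)) p := by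
  have : MDifferentiableAt (𝓡 4) ((𝓡 4).prod 𝓘(ℝ, ℝ))
      (fun m ↦ TotalSpace.mk' ℝ (E := Bundle.Trivial M ℝ) m (g.toFun m (V m) (W m))) p := by
    apply MDifferentiableAt.clm_bundle_apply₂ (F₁ := EuclideanSpace ℝ (Fin 4))
      (F₂ := EuclideanSpace ℝ (Fin 4))
    · exact (g.contMDiff p).mdifferentiableAt (by simp)
    · exact hV
    · exact hW
  exact ((mdifferentiableAt_totalSpace _ _).1 this).2

/-- The vector metrically dual to a covector. -/
noncomputable def sharp (p : M) (φ : Module.Dual ℝ (TangentSpace (𝓡 4) p)) :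
    TangentSpace (𝓡 4) p :=
  ((g.form p).toDual (g.form_nondegenerate p)).symm φ

/-- The gradient of a function. -/
noncomputable def grad (φ : M → ℝ) (p : M) : TangentSpace (𝓡 4) p :=
  g.sharp p (mvfderiv (𝓡 4) φ p).toLinearMap

/-- The one-form `k♭ = g(k, ·)`. -/
noncomputable def flat (k : SmoothVectorField M) (p : M) : TangentSpace (𝓡 4) p →ₗ[ℝ] ℝ :=
  g.form p (k p)

/-- The right-hand side of the Koszul formula for `2 g(∇_V X, W)`. -/
noncomputable def koszulExpr (X V W : (p : M) → TangentSpace (𝓡 4) p) (p : M) : ℝ :=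
  dirDeriv (fun q => g.form q (X q) (W q)) p (V p)
    + dirDeriv (fun q => g.form q (V q) (W q)) p (X p)
    - dirDeriv (fun q => g.form q (V q) (X q)) p (W p)
    + g.form p (mlieBracket (𝓡 4) V X p) (W p)
    - g.form p (mlieBracket (𝓡 4) V W p) (X p)
    - g.form p (mlieBracket (𝓡 4) X W p) (V p)

theorem koszul_tensorial_left (X : SmoothVectorField M) (p : M)
    (W : (p : M) → TangentSpace (𝓡 4) p) (hW : DiffFieldAt W p) :
    TensorialAt (𝓡 4) (EuclideanSpace ℝ (Fin 4)) (fun V => g.koszulExpr X V W p) p where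
  smul {f V} hf hV := by
    have hX : DiffFieldAt X p :=
      (X.contMDiff p).mdifferentiableAt (by simp)
    simp only [koszulExpr, mlieBracket_smul_left hf hV, Pi.smul_apply', map_smul, map_add,
      LinearMap.smul_apply, LinearMap.add_apply, smul_eq_mul]
    rw [dirDeriv_mul hf (g.mdifferentiableAt_inner hV hW),
      dirDeriv_mul hf (g.mdifferentiableAt_inner hV hX)]
    simp only [dirDeriv, map_smul, smul_eq_mul]
    ring
  add {V V'} hV hV' := by
    have hX : DiffFieldAt X p :=
      (X.contMDiff p).mdifferentiableAt (by simp)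
    simp only [koszulExpr, mlieBracket_add_left hV hV', Pi.add_apply, map_add,
      LinearMap.add_apply]
    rw [dirDeriv_add (g.mdifferentiableAt_inner hV hW) (g.mdifferentiableAt_inner hV' hW),
      dirDeriv_add (g.mdifferentiableAt_inner hV hX) (g.mdifferentiableAt_inner hV' hX)]
    simp only [dirDeriv, map_add]
    ring

theorem koszul_tensorial_right (X : SmoothVectorField M) (p : M)
    (V : (p : M) → TangentSpace (𝓡 4) p) (hV : DiffFieldAt V p) :
    TensorialAt (𝓡 4) (EuclideanSpace ℝ (Fin 4)) (fun W => g.koszulExpr X V W p) p where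
  smul {f W} hf hW := by
    have hX : DiffFieldAt X p :=
      (X.contMDiff p).mdifferentiableAt (by simp)
    simp only [koszulExpr, mlieBracket_smul_right hf hW, Pi.smul_apply', map_smul, map_add,
      LinearMap.smul_apply, LinearMap.add_apply, smul_eq_mul]
    rw [dirDeriv_mul hf (g.mdifferentiableAt_inner hX hW),
      dirDeriv_mul hf (g.mdifferentiableAt_inner hV hW)]
    simp only [dirDeriv, map_smul, smul_eq_mul]
    rw [g.form_symm p (W p) (X p), g.form_symm p (W p) (V p)]
    ring
  add {W W'} hW hW' := by
    have hX : DiffFieldAt X p :=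
      (X.contMDiff p).mdifferentiableAt (by simp)
    simp only [koszulExpr, mlieBracket_add_right hW hW', Pi.add_apply, map_add,
      LinearMap.add_apply]
    rw [dirDeriv_add (g.mdifferentiableAt_inner hX hW) (g.mdifferentiableAt_inner hX hW'),
      dirDeriv_add (g.mdifferentiableAt_inner hV hW) (g.mdifferentiableAt_inner hV hW')]
    simp only [dirDeriv, map_add]
    ring

/-- The bilinear form `(v, w) ↦ 2 g(∇_v X, w)` on a tangent space, given by the Koszul formula. -/
noncomputable def koszul (X : SmoothVectorField M) (p : M) :
    TangentSpace (𝓡 4) p →L[ℝ] TangentSpace (𝓡 4) p →L[ℝ] ℝ :=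
  TensorialAt.mkHom₂ (fun V W => g.koszulExpr X V W p) p
    (g.koszul_tensorial_left X p) (g.koszul_tensorial_right X p)

/-- The operator `∇X : v ↦ ∇_v X` on a tangent space, for the Levi-Civita connection `∇` of `g`. -/
noncomputable def nabla (X : SmoothVectorField M) (p : M) :
    TangentSpace (𝓡 4) p →ₗ[ℝ] TangentSpace (𝓡 4) p where
  toFun v := g.sharp p ((1 / 2 : ℝ) • (g.koszul X p v).toLinearMap)
  map_add' v w := by simp [sharp]
  map_smul' c v := by
    simp only [sharp, map_smul, ContinuousLinearMap.toLinearMap_smul, RingHom.id_apply]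
    rw [smul_comm]

theorem two_mul_form_nabla (X : SmoothVectorField M) {V W : (p : M) → TangentSpace (𝓡 4) p}
    {p : M} (hV : DiffFieldAt V p) (hW : DiffFieldAt W p) :
    2 * g.form p (g.nabla X p (V p)) (W p) = g.koszulExpr X V W p := by
  have h : g.koszul X p (V p) (W p) = g.koszulExpr X V W p :=
    TensorialAt.mkHom₂_apply _ _ hV hW
  rw [← h]
  simp [nabla, sharp]

/-- The vertical space `𝒱 = span(k, t)`. -/
noncomputable def vertical (k t : SmoothVectorField M) (p : M) : Submodule ℝ (TangentSpace (𝓡 4) p) :=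
  Submodule.span ℝ {k p, t p}

/-- The horizontal space `ℋ`, the orthogonal complement of `𝒱`. -/
noncomputable def horizontal (k t : SmoothVectorField M) (p : M) :
    Submodule ℝ (TangentSpace (𝓡 4) p) :=
  horSpace (g.form p) (k p) (t p)

open Classical in
/-- The projection onto the horizontal space along the vertical space
(they are complementary under the standing assumptions). -/
noncomputable def horProj (k t : SmoothVectorField M) (p : M) :
    TangentSpace (𝓡 4) p →ₗ[ℝ] TangentSpace (𝓡 4) p :=
  if h : IsCompl (g.horizontal k t p) (vertical k t p) then Submodule.projection _ _ h else 0

/-- The operator `π ∘ ∇X` on the horizontal space, extended by zero to the vertical space. -/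
noncomputable def horNabla (k t X : SmoothVectorField M) (p : M) :
    TangentSpace (𝓡 4) p →ₗ[ℝ] TangentSpace (𝓡 4) p :=
  g.horProj k t p ∘ₗ g.nabla X p ∘ₗ g.horProj k t p

/-- The relative shear operator `∇ᵒX`: the trace-free symmetric part of `π ∘ ∇X` on the horizontal
space (which has rank two). As `ℋ` and `𝒱` are orthogonal, adjoint and trace may be
computed for the extension by zero to the whole tangent space. -/
noncomputable def relShear (k t X : SmoothVectorField M) (p : M) :
    TangentSpace (𝓡 4) p →ₗ[ℝ] TangentSpace (𝓡 4) p :=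
  (1 / 2 : ℝ) • (g.horNabla k t X p +
      (g.form p).leftAdjointOfNondegenerate (g.form_nondegenerate p) (g.horNabla k t X p)) -
    (LinearMap.trace ℝ _ (g.horNabla k t X p) / 2) • g.horProj k t p

variable (o : ManifoldOrientation M)

open Classical in
/-- The almost complex structure `J = J_{g,k,t}`: the unique endomorphism with the defining
properties of `IsAdmissibleEndo`. -/
noncomputable def acs (k t : SmoothVectorField M) (p : M) :
    TangentSpace (𝓡 4) p →ₗ[ℝ] TangentSpace (𝓡 4) p :=
  if h : ∃ J, IsAdmissibleEndo (g.form p) (o.toFun p) (k p) (t p) J then h.choose else 0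

/-- The function `ι = g(∇_y k, x) - g(∇_x k, y)`, where `x, y` is an oriented orthonormal frame of
the horizontal space. -/
noncomputable def twist (k t : SmoothVectorField M) (p : M) : ℝ :=
  let e : TangentSpace (𝓡 4) p × TangentSpace (𝓡 4) p :=
    Classical.epsilon fun e => IsHorFrame (g.form p) (o.toFun p) (k p) (t p) e.1 e.2
  g.form p (g.nabla k p e.2) e.1 - g.form p (g.nabla k p e.1) e.2

/-- The Gram determinant `G` of `k`, `t`. -/
noncomputable def gram (k t : SmoothVectorField M) (p : M) : ℝ :=
  Matrix.det !![g.form p (k p) (k p), g.form p (k p) (t p);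
    g.form p (t p) (k p), g.form p (t p) (t p)]

theorem isAdmissibleEndo_acs {k t : SmoothVectorField M} {p : M}
    (hli : LinearIndependent ℝ ![k p, t p]) (hpos : IsPosOnHor (g.form p) (k p) (t p)) :
    IsAdmissibleEndo (g.form p) (o.toFun p) (k p) (t p) (g.acs o k t p) := by
  have h := (existsUnique_isAdmissibleEndo (finrank_tangentSpace p) (o.toFun p)
    (g.form_symm p) hli hpos).exists
  rw [acs, dif_pos h]
  exact h.choose_spec

theorem twist_eq {k t : SmoothVectorField M} {p : M}
    (hpos : IsPosOnHor (g.form p) (k p) (t p)) {x y : TangentSpace (𝓡 4) p}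
    (h : IsHorFrame (g.form p) (o.toFun p) (k p) (t p) x y) :
    g.twist o k t p = g.form p (g.nabla k p y) x - g.form p (g.nabla k p x) y := by
  have h' := Classical.epsilon_spec (p := fun e : TangentSpace (𝓡 4) p × TangentSpace (𝓡 4) p =>
    IsHorFrame (g.form p) (o.toFun p) (k p) (t p) e.1 e.2) ⟨(x, y), h⟩
  exact h.skew_eq (g.form_symm p) hpos h' (g.nabla k p)

/-- `(M, g)` is admissible, with distinguished vector fields `k`, `t` and functions `τ`, `ℓ`. -/
structure IsAdmissible (k t : SmoothVectorField M)
    (τ ℓ : ContMDiffMap (𝓡 4) 𝓘(ℝ, ℝ) M ℝ ∞) : Prop where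
  linearIndependent (p : M) : LinearIndependent ℝ ![k p, t p]
  spacelike (p : M) : ∀ v ∈ g.horizontal k t p, v ≠ 0 → 0 < g.form p v v
  bracket_k (p : M) (X : (q : M) → TangentSpace (𝓡 4) q) : SmoothFieldAt X p →
    (∀ᶠ q in nhds p, X q ∈ g.horizontal k t q) → mlieBracket (𝓡 4) k X p ∈ g.horizontal k t p
  bracket_t (p : M) (X : (q : M) → TangentSpace (𝓡 4) q) : SmoothFieldAt X p →
    (∀ᶠ q in nhds p, X q ∈ g.horizontal k t q) → mlieBracket (𝓡 4) t X p ∈ g.horizontal k t p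
  shear (p : M) : ∀ v ∈ g.horizontal k t p,
    g.acs o k t p (g.relShear k t k p v) = g.relShear k t t p v
  t_eq (p : M) : t p = ℓ p • g.grad τ p
  grad_kt (p : M) : g.grad (fun q => g.form q (k q) (t q)) p ∈ vertical k t p
  grad_kk (p : M) : g.grad (fun q => g.form q (k q) (k q)) p ∈ vertical k t p

/-- The two-form `ω = d(f(τ) k♭)`. -/
noncomputable def omega (k : SmoothVectorField M) (τ : M → ℝ) (f : ℝ → ℝ) (p : M)
    (v w : TangentSpace (𝓡 4) p) : ℝ :=
  exteriorDeriv (fun q => f (τ q) • g.flat k q) p v w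

/-- The tensor `g_K = ω(·, J ·)`. -/
noncomputable def kahlerTensor (k t : SmoothVectorField M) (τ : M → ℝ) (f : ℝ → ℝ) (p : M)
    (v w : TangentSpace (𝓡 4) p) : ℝ :=
  g.omega k τ f p v (g.acs o k t p w)

/-- The region on which `g_K` is the induced Kähler metric. -/
def kahlerRegion (k t : SmoothVectorField M) (τ ℓ : M → ℝ) (f : ℝ → ℝ) : Set M :=
  {p | f (τ p) * g.twist o k t p < 0 ∧
    deriv f (τ p) * g.gram k t p / ℓ p -
      f (τ p) * exteriorDeriv (g.flat k) p (k p) (t p) < 0}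

end SemiRiemannianMetric

end Geometry

/-! ### Smoothness at a point, Lie brackets and directional derivatives -/

section Calculus

open Bundle VectorField Filter Topology

variable {M : Type*} [TopologicalSpace M] [ChartedSpace (EuclideanSpace ℝ (Fin 4)) M]
  [IsManifold (𝓡 4) ∞ M]

set_option linter.unusedSectionVars false

/-! Write `g_K = dα(·, J·)` with `α = f(τ) k♭`. Both ingredients are invariant under `k`, hence so
is `g_K`.

The form. Since `k` is Killing and `[k, k] = 0`, the Lie derivative of `k♭` along `k` vanishes.
Moreover `0 = g(t, k) = ℓ dτ(k)`, and `ℓ` has no zeros because `t = ℓ ∇τ` has none, so `τ` and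
`f(τ)` are constant along `k` (`IsAdmissible.dirDeriv_tau`). Thus `L_k α = 0`
(`isInvariantForm_smul_flat`), and `L_k dα = 0` because the exterior derivative commutes with the
Lie derivative (`IsInvariantForm.exteriorDeriv`). The latter rests on the Jacobi identity and on the
bracket acting on functions as a commutator.

The complex structure. The operator `[k, ·]` annihilates `k` and `t` and preserves sections of `ℋ`.
For a local oriented orthonormal frame `x, y` of `ℋ` the Killing equation makes it skew: `[k, x] = λ
y` and `[k, y] = -λ x`. An infinitesimal rotation of a plane commutes with the quarter turn, so `L_k
J = 0` (`IsAdmissible.acs_invariant`). The frame (`IsAdmissible.exists_local_frame`) also shows that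
`J` takes smooth fields to smooth fields. -/

theorem minSmoothness_le_infty (n : ℕ) : minSmoothness ℝ n ≤ (∞ : ℕ∞ω) := by
  simp only [minSmoothness_of_isRCLikeNormedField]
  exact_mod_cast (le_top : (n : ℕ∞) ≤ ⊤)

theorem isManifold_minSmoothness (n : ℕ) : IsManifold (𝓡 4) (minSmoothness ℝ n) M :=
  IsManifold.of_le (minSmoothness_le_infty n)

/-- A real function which is smooth at the point `p`. -/
abbrev SmoothFunAt (φ : M → ℝ) (p : M) : Prop :=
  ContMDiffAt (𝓡 4) 𝓘(ℝ, ℝ) ∞ φ p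

theorem SmoothFunAt.diff {φ : M → ℝ} {p : M} (h : SmoothFunAt φ p) :
    MDifferentiableAt (𝓡 4) 𝓘(ℝ, ℝ) φ p :=
  h.mdifferentiableAt (by simp)

theorem SmoothFieldAt.diff {X : (q : M) → TangentSpace (𝓡 4) q} {p : M}
    (h : SmoothFieldAt X p) : DiffFieldAt X p :=
  ContMDiffAt.mdifferentiableAt h (by simp)

/-- Being `C^∞` at `p` need not persist on a neighbourhood, since the neighbourhoods on which the
field is `C^n` may shrink with `n`. Being `C^1` does persist, which is why the argument descends to
order one and only differentiability is available near `p`. -/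
theorem SmoothFieldAt.eventually_diff {X : (q : M) → TangentSpace (𝓡 4) q} {p : M}
    (h : SmoothFieldAt X p) : ∀ᶠ q in 𝓝 p, DiffFieldAt X q := by
  have : IsManifold (𝓡 4) (1 + 1) M := IsManifold.of_le (n := ∞)
    (by simpa [one_add_one_eq_two] using minSmoothness_le_infty 2)
  have : IsManifold (𝓡 4) 1 M := IsManifold.of_le (n := ∞) (by simp)
  have h1 : ContMDiffAt (𝓡 4) (𝓡 4).tangent 1
      (fun q => (⟨q, X q⟩ : TangentBundle (𝓡 4) M)) p :=
    ContMDiffAt.of_le h (by exact_mod_cast le_top)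
  filter_upwards [(contMDiffAt_iff_contMDiffAt_nhds (by simp)).1 h1] with q hq
  exact ContMDiffAt.mdifferentiableAt hq one_ne_zero

theorem SmoothFunAt.eventually_diff {φ : M → ℝ} {p : M} (h : SmoothFunAt φ p) :
    ∀ᶠ q in 𝓝 p, MDifferentiableAt (𝓡 4) 𝓘(ℝ, ℝ) φ q := by
  have : IsManifold (𝓡 4) 1 M := IsManifold.of_le (n := ∞) (by simp)
  have h1 : ContMDiffAt (𝓡 4) 𝓘(ℝ, ℝ) 1 φ p := h.of_le (by exact_mod_cast le_top)
  filter_upwards [(contMDiffAt_iff_contMDiffAt_nhds (by simp)).1 h1] with q hq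
  exact ContMDiffAt.mdifferentiableAt hq one_ne_zero

theorem smoothFieldAt_extend {p : M} (v : TangentSpace (𝓡 4) p) :
    SmoothFieldAt (FiberBundle.extend (EuclideanSpace ℝ (Fin 4)) v) p :=
  FiberBundle.contMDiffAt_extend (𝓡 4) (EuclideanSpace ℝ (Fin 4)) v

theorem SmoothVectorField.smoothFieldAt (X : SmoothVectorField M) (p : M) :
    SmoothFieldAt X p := X.contMDiff p

theorem SmoothFieldAt.add {X Y : (q : M) → TangentSpace (𝓡 4) q} {p : M}
    (hX : SmoothFieldAt X p) (hY : SmoothFieldAt Y p) : SmoothFieldAt (X + Y) p :=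
  ContMDiffAt.add_section hX hY

theorem SmoothFieldAt.sub {X Y : (q : M) → TangentSpace (𝓡 4) q} {p : M}
    (hX : SmoothFieldAt X p) (hY : SmoothFieldAt Y p) : SmoothFieldAt (X - Y) p :=
  ContMDiffAt.sub_section hX hY

theorem SmoothFieldAt.smul {φ : M → ℝ} {X : (q : M) → TangentSpace (𝓡 4) q} {p : M}
    (hφ : SmoothFunAt φ p) (hX : SmoothFieldAt X p) : SmoothFieldAt (φ • X) p :=
  ContMDiffAt.smul_section hφ hX

theorem SmoothFieldAt.congr {X Y : (q : M) → TangentSpace (𝓡 4) q} {p : M}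
    (hX : SmoothFieldAt X p) (h : Y =ᶠ[𝓝 p] X) : SmoothFieldAt Y p :=
  ContMDiffAt.congr_of_eventuallyEq hX (h.mono fun q hq => by simp [hq])

theorem SmoothFieldAt.mlieBracket {X Y : (q : M) → TangentSpace (𝓡 4) q} {p : M}
    (hX : SmoothFieldAt X p) (hY : SmoothFieldAt Y p) :
    SmoothFieldAt (mlieBracket (𝓡 4) X Y) p := by
  have : IsManifold (𝓡 4) (((⊤ : ℕ∞) : ℕ∞ω) + 1) M := by
    simpa using (inferInstance : IsManifold (𝓡 4) ∞ M)
  have : IsManifold (𝓡 4) (minSmoothness ℝ 2) M := isManifold_minSmoothness 2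
  have : IsManifold (𝓡 4) (minSmoothness ℝ 3) M := isManifold_minSmoothness 3
  exact ContMDiffAt.mlieBracket_vectorField (m := ⊤) (n := ⊤) hX hY (by simp)

theorem SmoothFunAt.dirDeriv {φ : M → ℝ} {X : (q : M) → TangentSpace (𝓡 4) q} {p : M}
    (hφ : SmoothFunAt φ p) (hX : SmoothFieldAt X p) :
    SmoothFunAt (fun q => dirDeriv φ q (X q)) p := by
  have h1 := ContMDiffAt.mfderiv_const (m := ∞) hφ (by simp)
  have h2 := ContMDiffAt.clm_apply_of_inCoordinates (F₁ := EuclideanSpace ℝ (Fin 4))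
    (F₂ := ℝ) (E₁ := TangentSpace (𝓡 4)) (E₂ := TangentSpace 𝓘(ℝ, ℝ)) (b₁ := id) (b₂ := φ)
    (v := X) h1 hX hφ
  have h3 := (contMDiffAt_totalSpace.1 h2).2
  have h4 : (fun q => _root_.dirDeriv φ q (X q)) = fun q => mfderiv (𝓡 4) 𝓘(ℝ, ℝ) φ q (X q) := rfl
  rw [h4]
  simpa using h3

theorem dirDeriv_congr {φ ψ : M → ℝ} {p : M} (h : φ =ᶠ[𝓝 p] ψ) (v : TangentSpace (𝓡 4) p) :
    dirDeriv φ p v = dirDeriv ψ p v := by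
  unfold dirDeriv mvfderiv
  simp only [h.mfderiv_eq]
  rfl

theorem dirDeriv_sub {φ ψ : M → ℝ} {p : M} (hφ : MDifferentiableAt (𝓡 4) 𝓘(ℝ, ℝ) φ p)
    (hψ : MDifferentiableAt (𝓡 4) 𝓘(ℝ, ℝ) ψ p) (v : TangentSpace (𝓡 4) p) :
    dirDeriv (fun q => φ q - ψ q) p v = dirDeriv φ p v - dirDeriv ψ p v := by
  unfold dirDeriv
  rw [show (fun q => φ q - ψ q) = φ - ψ from rfl, mvfderiv_sub hφ hψ]
  rfl

theorem dirDeriv_const (c : ℝ) (p : M) (v : TangentSpace (𝓡 4) p) :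
    dirDeriv (fun _ => c) p v = 0 := by
  unfold dirDeriv
  rw [mvfderiv_const]
  rfl

theorem mlieBracket_jacobi {X Y Z : (q : M) → TangentSpace (𝓡 4) q} {p : M}
    (hX : SmoothFieldAt X p) (hY : SmoothFieldAt Y p) (hZ : SmoothFieldAt Z p) :
    mlieBracket (𝓡 4) X (mlieBracket (𝓡 4) Y Z) p =
      mlieBracket (𝓡 4) (mlieBracket (𝓡 4) X Y) Z p +
        mlieBracket (𝓡 4) Y (mlieBracket (𝓡 4) X Z) p := by
  have two := minSmoothness_le_infty 2
  have : IsManifold (𝓡 4) (minSmoothness ℝ 3) M := isManifold_minSmoothness 3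
  exact leibniz_identity_mlieBracket_apply
    (ContMDiffAt.of_le hX two) (ContMDiffAt.of_le hY two) (ContMDiffAt.of_le hZ two)

/-- The Lie bracket acts on functions as the commutator of derivations. -/
theorem dirDeriv_mlieBracket {φ : M → ℝ} {X Y : (q : M) → TangentSpace (𝓡 4) q} {p : M}
    (hφ : SmoothFunAt φ p) (hX : SmoothFieldAt X p) (hY : SmoothFieldAt Y p) :
    dirDeriv φ p (mlieBracket (𝓡 4) X Y p) =
      dirDeriv (fun q => dirDeriv φ q (Y q)) p (X p) -
        dirDeriv (fun q => dirDeriv φ q (X q)) p (Y p) := by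
  -- The Jacobi identity is tested on `X, Y, φW` with `W p = w ≠ 0`. The cross terms `(Xφ)[Y, W] +
  -- (Yφ)[X, W]` occur on both sides and `φ` times the Jacobi identity for `W` drops out. What is
  -- left is the wanted scalar identity multiplied by `w`.
  obtain ⟨w, hw⟩ : ∃ w : TangentSpace (𝓡 4) p, w ≠ 0 :=
    exists_ne (α := EuclideanSpace ℝ (Fin 4)) 0
  set W := FiberBundle.extend (EuclideanSpace ℝ (Fin 4)) w
  have hW : SmoothFieldAt W p := smoothFieldAt_extend w
  have hWp : W p = w := by simp [W]
  have expand : ∀ {Z V : (q : M) → TangentSpace (𝓡 4) q}, SmoothFieldAt V p →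
      mlieBracket (𝓡 4) Z (φ • V) =ᶠ[𝓝 p]
        (fun q => dirDeriv φ q (Z q)) • V + φ • mlieBracket (𝓡 4) Z V := by
    intro Z V hV
    filter_upwards [hφ.eventually_diff, hV.eventually_diff] with q h1 h2
    rw [mlieBracket_smul_right h1 h2]
    rfl
  have outer : ∀ {Z V : (q : M) → TangentSpace (𝓡 4) q}, SmoothFieldAt Z p → SmoothFieldAt V p →
      mlieBracket (𝓡 4) V (mlieBracket (𝓡 4) Z (φ • W)) p =
        dirDeriv (fun q => dirDeriv φ q (Z q)) p (V p) • W p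
        + dirDeriv φ p (Z p) • mlieBracket (𝓡 4) V W p
        + (dirDeriv φ p (V p) • mlieBracket (𝓡 4) Z W p
        + φ p • mlieBracket (𝓡 4) V (mlieBracket (𝓡 4) Z W) p) := by
    intro Z V hZ hV
    have hd := hφ.dirDeriv hZ
    have hb := hZ.mlieBracket hW
    refine (EventuallyEq.mlieBracket_vectorField_eq EventuallyEq.rfl (expand hW)).trans ?_
    rw [mlieBracket_add_right (hW.smul hd).diff (hb.smul hφ).diff,
      mlieBracket_smul_right hd.diff hW.diff, mlieBracket_smul_right hφ.diff hb.diff]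
    rfl
  have j1 := mlieBracket_jacobi hX hY (hW.smul hφ)
  have j2 := mlieBracket_jacobi hX hY hW
  rw [outer hY hX, outer hX hY, (expand hW).self_of_nhds] at j1
  simp only [Pi.add_apply, Pi.smul_apply', j2] at j1
  rw [hWp] at j1
  have h : (dirDeriv (fun q => dirDeriv φ q (Y q)) p (X p) -
      dirDeriv (fun q => dirDeriv φ q (X q)) p (Y p) -
      dirDeriv φ p (mlieBracket (𝓡 4) X Y p)) • w = 0 := by
    rw [← sub_eq_zero] at j1
    rw [← j1]
    module
  linarith [(smul_eq_zero.1 h).resolve_right hw]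

end Calculus

/-! ### Invariant one-forms and their exterior derivatives -/

section Invariance

open Bundle VectorField Filter Topology

variable {M : Type*} [TopologicalSpace M] [ChartedSpace (EuclideanSpace ℝ (Fin 4)) M]
  [IsManifold (𝓡 4) ∞ M]

/-- A smooth one-form, by its effect on vector fields. -/
structure IsSmoothForm (α : (p : M) → TangentSpace (𝓡 4) p →ₗ[ℝ] ℝ) : Prop where
  diff (p : M) (V : (q : M) → TangentSpace (𝓡 4) q) : DiffFieldAt V p →
    MDifferentiableAt (𝓡 4) 𝓘(ℝ, ℝ) (fun q => α q (V q)) p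
  smooth (p : M) (V : (q : M) → TangentSpace (𝓡 4) q) : SmoothFieldAt V p →
    SmoothFunAt (fun q => α q (V q)) p

/-- The one-form `α` has vanishing Lie derivative along `k`. -/
def IsInvariantForm (α : (p : M) → TangentSpace (𝓡 4) p →ₗ[ℝ] ℝ)
    (k : (p : M) → TangentSpace (𝓡 4) p) : Prop :=
  ∀ (p : M) (V : (q : M) → TangentSpace (𝓡 4) q), SmoothFieldAt V p →
    dirDeriv (fun q => α q (V q)) p (k p) = α p (mlieBracket (𝓡 4) k V p)

/-- The difference of the two sides is tensorial in `V`, as the derivatives of a scalar factor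
cancel. It therefore depends only on `V p`, and it vanishes on the smooth extension of that vector.
The weaker assumption on `V` is needed because a field smooth at `p` is only known to be
differentiable at the points nearby. -/
theorem IsInvariantForm.of_diff {α : (p : M) → TangentSpace (𝓡 4) p →ₗ[ℝ] ℝ}
    {k : (p : M) → TangentSpace (𝓡 4) p} (hα : IsSmoothForm α) (hk : IsInvariantForm α k)
    {p : M} {V : (q : M) → TangentSpace (𝓡 4) q} (hV : DiffFieldAt V p) :
    dirDeriv (fun q => α q (V q)) p (k p) = α p (mlieBracket (𝓡 4) k V p) := by
  have hT : TensorialAt (𝓡 4) (EuclideanSpace ℝ (Fin 4))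
      (fun V : (q : M) → TangentSpace (𝓡 4) q =>
        dirDeriv (fun q => α q (V q)) p (k p) - α p (mlieBracket (𝓡 4) k V p)) p :=
    { smul := fun {f V} hf hV => by
        simp only [mlieBracket_smul_right hf hV, Pi.smul_apply', map_smul, map_add, smul_eq_mul]
        rw [dirDeriv_mul hf (hα.diff p V hV)]
        simp only [dirDeriv]
        ring
      add := fun {V W} hV hW => by
        simp only [mlieBracket_add_right hV hW, Pi.add_apply, map_add]
        rw [dirDeriv_add (hα.diff p V hV) (hα.diff p W hW)]
        ring }
  have hE := smoothFieldAt_extend (V p)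
  have h := hT.pointwise hE.diff hV (by simp)
  rw [hk p _ hE, sub_self] at h
  linarith

theorem IsSmoothForm.exteriorDeriv_apply {α : (p : M) → TangentSpace (𝓡 4) p →ₗ[ℝ] ℝ}
    (hα : IsSmoothForm α) {p : M} {V W : (q : M) → TangentSpace (𝓡 4) q}
    (hV : DiffFieldAt V p) (hW : DiffFieldAt W p) :
    exteriorDeriv α p (V p) (W p) =
      dirDeriv (fun q => α q (W q)) p (V p) - dirDeriv (fun q => α q (V q)) p (W p) -
        α p (mlieBracket (𝓡 4) V W p) :=
  _root_.exteriorDeriv_apply (hα.diff p) hV hW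

/-- The exterior derivative of an invariant one-form is invariant. -/
theorem IsInvariantForm.exteriorDeriv {α : (p : M) → TangentSpace (𝓡 4) p →ₗ[ℝ] ℝ}
    {k : SmoothVectorField M} (hα : IsSmoothForm α) (hk : IsInvariantForm α k)
    {p : M} {V W : (q : M) → TangentSpace (𝓡 4) q}
    (hV : SmoothFieldAt V p) (hW : SmoothFieldAt W p) :
    dirDeriv (fun q => exteriorDeriv α q (V q) (W q)) p (k p) =
      exteriorDeriv α p (mlieBracket (𝓡 4) k V p) (W p) +
        exteriorDeriv α p (V p) (mlieBracket (𝓡 4) k W p) := by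
  have hks := k.smoothFieldAt p
  have hVW := hV.mlieBracket hW
  have hkV := hks.mlieBracket hV
  have hkW := hks.mlieBracket hW
  have hαV := hα.smooth p V hV
  have hαW := hα.smooth p W hW
  -- These three identities are about to be differentiated at `p`, so they must hold on a
  -- neighbourhood.
  have h1 : (fun q => _root_.exteriorDeriv α q (V q) (W q)) =ᶠ[𝓝 p] fun q =>
      (dirDeriv (fun q => α q (W q)) q (V q) - dirDeriv (fun q => α q (V q)) q (W q)) -
        α q (mlieBracket (𝓡 4) V W q) := by
    filter_upwards [hV.eventually_diff, hW.eventually_diff] with q hq hq'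
    exact hα.exteriorDeriv_apply hq hq'
  have h2 : (fun q => dirDeriv (fun q => α q (V q)) q (k q)) =ᶠ[𝓝 p]
      fun q => α q (mlieBracket (𝓡 4) k V q) := by
    filter_upwards [hV.eventually_diff] with q hq using hk.of_diff hα hq
  have h3 : (fun q => dirDeriv (fun q => α q (W q)) q (k q)) =ᶠ[𝓝 p]
      fun q => α q (mlieBracket (𝓡 4) k W q) := by
    filter_upwards [hW.eventually_diff] with q hq using hk.of_diff hα hq
  have hd1 := hαW.dirDeriv hV
  have hd2 := hαV.dirDeriv hW
  have hd12 : MDifferentiableAt (𝓡 4) 𝓘(ℝ, ℝ) (fun q => dirDeriv (fun q => α q (W q)) q (V q) -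
      dirDeriv (fun q => α q (V q)) q (W q)) p := hd1.diff.sub hd2.diff
  -- Second derivatives are reordered by `[k, V] = kV - Vk` and `[k, W] = kW - Wk` on functions.
  -- Invariance turns `k(α V)` and `k(α W)` into `α [k, V]` and `α [k, W]`, and the Jacobi identity
  -- splits `α [k, [V, W]]`.
  rw [dirDeriv_congr h1, dirDeriv_sub hd12 (hα.smooth p _ hVW).diff,
    dirDeriv_sub hd1.diff hd2.diff, hk p _ hVW, hα.exteriorDeriv_apply hkV.diff hW.diff,
    hα.exteriorDeriv_apply hV.diff hkW.diff, mlieBracket_jacobi hks hV hW,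
    dirDeriv_mlieBracket hαW hks hV, dirDeriv_mlieBracket hαV hks hW,
    dirDeriv_congr h2, dirDeriv_congr h3, map_add]
  ring

end Invariance

/-! ### Linear algebra of adapted frames when `k` and `t` are orthogonal -/

section Frames

variable {W : Type*} [AddCommGroup W] [Module ℝ W]

/-- A null vector among two orthogonal ones would be orthogonal to both, hence would lie in their
span and in its orthogonal complement. These meet only in zero. The lemma licenses dividing by `B k
k` and `B t t`. -/
theorem form_self_ne_zero [FiniteDimensional ℝ W] {B : LinearMap.BilinForm ℝ W} {k t v : W}
    (hB : ∀ v w, B v w = B w v) (hpos : IsPosOnHor B k t) (hv : v ∈ ({k, t} : Set W))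
    (hv0 : v ≠ 0) (hkt : B k t = 0) : B v v ≠ 0 := by
  intro h
  refine hv0 (Submodule.disjoint_def.1 (isCompl_horSpace hB hpos).disjoint v
    (Submodule.subset_span hv) (mem_horSpace.2 ?_))
  rcases hv with rfl | rfl
  · exact ⟨h, by rw [hB, hkt]⟩
  · exact ⟨hkt, h⟩

/-- The component of `v` orthogonal to the orthogonal vectors `k` and `t`. -/
noncomputable def horPart (B : LinearMap.BilinForm ℝ W) (k t v : W) : W :=
  v - (B v k / B k k) • k - (B v t / B t t) • t

theorem horPart_mem {B : LinearMap.BilinForm ℝ W} {k t : W} (hB : ∀ v w, B v w = B w v)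
    (hkk : B k k ≠ 0) (htt : B t t ≠ 0) (hkt : B k t = 0) (v : W) :
    horPart B k t v ∈ horSpace B k t := by
  rw [mem_horSpace, horPart]
  simp only [map_sub, map_smul, smul_eq_mul, hkt, hB t k, hB v k, hB v t]
  constructor <;> field_simp <;> ring

theorem horPart_of_mem {B : LinearMap.BilinForm ℝ W} {k t v : W} (hB : ∀ v w, B v w = B w v)
    (hv : v ∈ horSpace B k t) : horPart B k t v = v := by
  rw [mem_horSpace] at hv
  simp [horPart, hB v k, hB v t, hv.1, hv.2]

/-- Coordinates of a vector in a frame made of `k`, `t` and an oriented orthonormal frame of the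
orthogonal complement. -/
theorem IsHorFrame.expand_full {B : LinearMap.BilinForm ℝ W} {o : Orientation ℝ W (Fin 4)}
    {k t x y : W} (hB : ∀ v w, B v w = B w v) (hpos : IsPosOnHor B k t)
    (h : IsHorFrame B o k t x y) (hkk : B k k ≠ 0) (htt : B t t ≠ 0) (hkt : B k t = 0) (v : W) :
    v = (B v k / B k k) • k + (B v t / B t t) • t + B v x • x + B v y • y := by
  have hx := mem_horSpace.1 h.mem_left
  have hy := mem_horSpace.1 h.mem_right
  have he := h.expand hB hpos (horPart_mem hB hkk htt hkt v)
  have e1 : B (horPart B k t v) x = B v x := by simp [horPart, hx.1, hx.2]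
  have e2 : B (horPart B k t v) y = B v y := by simp [horPart, hy.1, hy.2]
  rw [e1, e2, horPart] at he
  rw [add_assoc, ← he]
  abel

theorem IsAdmissibleEndo.map_right {B : LinearMap.BilinForm ℝ W} {o : Orientation ℝ W (Fin 4)}
    {k t x y : W} {J : W →ₗ[ℝ] W} (hB : ∀ v w, B v w = B w v) (hpos : IsPosOnHor B k t)
    (hJ : IsAdmissibleEndo B o k t J) (h : IsHorFrame B o k t x y) : J y = -x := by
  rw [← hJ.map_left hB hpos h, hJ.sq_hor x h.mem_left]

/-- This makes explicit an endomorphism otherwise known only through its defining properties. Along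
a smooth frame all the coefficients are smooth, so regularity and brackets of `J b` can be read off.
-/
theorem IsAdmissibleEndo.apply_eq {B : LinearMap.BilinForm ℝ W} {o : Orientation ℝ W (Fin 4)}
    {k t x y : W} {J : W →ₗ[ℝ] W} (hB : ∀ v w, B v w = B w v) (hpos : IsPosOnHor B k t)
    (hJ : IsAdmissibleEndo B o k t J) (h : IsHorFrame B o k t x y)
    (hkk : B k k ≠ 0) (htt : B t t ≠ 0) (hkt : B k t = 0) (v : W) :
    J v = (B v k / B k k) • t - (B v t / B t t) • k + B v x • y - B v y • x := by
  conv_lhs => rw [h.expand_full hB hpos hkk htt hkt v]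
  simp only [map_add, map_smul, hJ.map_k, hJ.map_t, hJ.map_left hB hpos h,
    hJ.map_right hB hpos h]
  module

end Frames

/-! ### Invariance of `f(τ) k♭` and of `J` under the Killing field -/

section KillingField

open Bundle VectorField Filter Topology

variable {M : Type*} [TopologicalSpace M] [ChartedSpace (EuclideanSpace ℝ (Fin 4)) M]
  [IsManifold (𝓡 4) ∞ M]

namespace SemiRiemannianMetric

variable (g : SemiRiemannianMetric M) {o : ManifoldOrientation M}

theorem smoothFunAt_inner {V W : (p : M) → TangentSpace (𝓡 4) p} {p : M}
    (hV : SmoothFieldAt V p) (hW : SmoothFieldAt W p) :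
    SmoothFunAt (fun q => g.form q (V q) (W q)) p := by
  have : ContMDiffAt (𝓡 4) ((𝓡 4).prod 𝓘(ℝ, ℝ)) ∞
      (fun m ↦ TotalSpace.mk' ℝ (E := Bundle.Trivial M ℝ) m (g.toFun m (V m) (W m))) p := by
    apply ContMDiffAt.clm_bundle_apply₂ (F₁ := EuclideanSpace ℝ (Fin 4))
      (F₂ := EuclideanSpace ℝ (Fin 4))
    · exact g.contMDiff p
    · exact hV
    · exact hW
  exact (contMDiffAt_totalSpace.1 this).2

theorem isSmoothForm_smul_flat {k : SmoothVectorField M} {φ : M → ℝ}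
    (hφ : ∀ p, SmoothFunAt φ p) : IsSmoothForm (fun q => φ q • g.flat k q) where
  diff p _ hV :=
    (hφ p).diff.mul (g.mdifferentiableAt_inner (k.smoothFieldAt p).diff hV)
  smooth p _ hV := (hφ p).mul (g.smoothFunAt_inner (k.smoothFieldAt p) hV)

/-- The Killing equation with first argument `k` loses its `[k, k]` term and becomes the invariance
of `k♭`; a factor constant along `k` does not disturb it. -/
theorem isInvariantForm_smul_flat {k : SmoothVectorField M} {φ : M → ℝ}
    (hk : IsKillingOn (fun p v w => g.form p v w) k Set.univ)
    (hφ : ∀ p, SmoothFunAt φ p) (hφk : ∀ p, dirDeriv φ p (k p) = 0) :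
    IsInvariantForm (fun q => φ q • g.flat k q) k := by
  intro p V hV
  have hks := k.smoothFieldAt p
  have h := hk p trivial k V hks hV
  simp only [mlieBracket_self, Pi.zero_apply, map_zero, LinearMap.zero_apply, zero_add] at h
  have h2 : dirDeriv (fun q => φ q * g.form q (k q) (V q)) p (k p) =
      φ p * g.form p (k p) (mlieBracket (𝓡 4) k V p) := by
    rw [dirDeriv_mul (hφ p).diff (g.smoothFunAt_inner hks hV).diff, h, hφk]
    ring
  exact h2

variable {g} {k t : SmoothVectorField M} {τ ℓ : ContMDiffMap (𝓡 4) 𝓘(ℝ, ℝ) M ℝ ∞}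

theorem IsAdmissible.isPosOnHor (hg : g.IsAdmissible o k t τ ℓ) (p : M) :
    IsPosOnHor (g.form p) (k p) (t p) := hg.spacelike p

theorem IsAdmissible.form_kk_ne_zero (hg : g.IsAdmissible o k t τ ℓ) {p : M}
    (hkt : g.form p (k p) (t p) = 0) : g.form p (k p) (k p) ≠ 0 :=
  form_self_ne_zero (g.form_symm p) (hg.isPosOnHor p) (by simp)
    ((hg.linearIndependent p).ne_zero 0) hkt

theorem IsAdmissible.form_tt_ne_zero (hg : g.IsAdmissible o k t τ ℓ) {p : M}
    (hkt : g.form p (k p) (t p) = 0) : g.form p (t p) (t p) ≠ 0 :=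
  form_self_ne_zero (g.form_symm p) (hg.isPosOnHor p) (by simp)
    ((hg.linearIndependent p).ne_zero 1) hkt

theorem form_grad (φ : M → ℝ) (p : M) (v : TangentSpace (𝓡 4) p) :
    g.form p (g.grad φ p) v = dirDeriv φ p v := by
  simp [grad, sharp, dirDeriv]

/-- From `t = ℓ ∇τ` one gets `0 = g(t, k) = ℓ dτ(k)`, and `ℓ p = 0` would force `t p = 0`. -/
theorem IsAdmissible.dirDeriv_tau (hg : g.IsAdmissible o k t τ ℓ) {p : M}
    (hkt : g.form p (k p) (t p) = 0) : dirDeriv τ p (k p) = 0 := by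
  have h : g.form p (t p) (k p) = ℓ p * dirDeriv τ p (k p) := by
    rw [← form_grad (g := g), hg.t_eq p]
    simp
  rw [g.form_symm, hkt, eq_comm, mul_eq_zero] at h
  refine h.resolve_left fun h0 => (hg.linearIndependent p).ne_zero 1 ?_
  simpa [h0] using hg.t_eq p

theorem smoothFieldAt_horPart (hg : g.IsAdmissible o k t τ ℓ)
    (hkt : ∀ p, g.form p (k p) (t p) = 0) {V : (p : M) → TangentSpace (𝓡 4) p} {p : M}
    (hV : SmoothFieldAt V p) :
    SmoothFieldAt (fun q => horPart (g.form q) (k q) (t q) (V q)) p := by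
  have hk := k.smoothFieldAt p
  have ht := t.smoothFieldAt p
  exact (hV.sub (hk.smul (ContMDiffAt.div₀ (g.smoothFunAt_inner hV hk) (g.smoothFunAt_inner hk hk)
    (hg.form_kk_ne_zero (hkt p))))).sub (ht.smul (ContMDiffAt.div₀ (g.smoothFunAt_inner hV ht)
    (g.smoothFunAt_inner ht ht) (hg.form_tt_ne_zero (hkt p))))

/-- Normalising a vector field which has length one at `p`. -/
theorem exists_normalize {V : (p : M) → TangentSpace (𝓡 4) p} {p : M} (hV : SmoothFieldAt V p)
    (hp : g.form p (V p) (V p) = 1) :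
    ∃ φ : M → ℝ, SmoothFunAt φ p ∧ φ p = 1 ∧
      ∀ᶠ q in 𝓝 p, g.form q ((φ • V) q) ((φ • V) q) = 1 := by
  have hs := g.smoothFunAt_inner hV hV
  have hsq : SmoothFunAt (fun q => Real.sqrt (g.form q (V q) (V q))) p :=
    (Real.contDiffAt_sqrt (by rw [hp]; exact one_ne_zero)).contMDiffAt.comp p hs
  refine ⟨fun q => (Real.sqrt (g.form q (V q) (V q)))⁻¹,
    ContMDiffAt.inv₀ hsq (by simp [hp]), by simp [hp], ?_⟩
  have hpos : ∀ᶠ q in 𝓝 p, 0 < g.form q (V q) (V q) :=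
    hs.continuousAt.eventually (lt_mem_nhds (by simp [hp]))
  filter_upwards [hpos] with q hq
  have h1 := Real.sqrt_pos.2 hq
  have h2 := Real.mul_self_sqrt hq.le
  simp only [Pi.smul_apply', map_smul, LinearMap.smul_apply, smul_eq_mul]
  field_simp
  nlinarith

/-- Smooth oriented orthonormal frames of the horizontal spaces exist locally. -/
theorem IsAdmissible.exists_local_frame (hg : g.IsAdmissible o k t τ ℓ)
    (hkt : ∀ p, g.form p (k p) (t p) = 0) (p : M) :
    ∃ x y : (q : M) → TangentSpace (𝓡 4) q, SmoothFieldAt x p ∧ SmoothFieldAt y p ∧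
      ∀ᶠ q in 𝓝 p, IsHorFrame (g.form q) (o.toFun q) (k q) (t q) (x q) (y q) := by
  -- An oriented orthonormal pair at `p` is extended, projected to `ℋ` and put through Gram–Schmidt.
  -- Nothing changes at `p`, where the pair is already adapted, so the norms stay positive near `p`
  -- and the orientation at `p` carries over to nearby points.
  obtain ⟨x₀, y₀, h₀⟩ := exists_isHorFrame (finrank_tangentSpace p) (o.toFun p) (g.form_symm p)
    (hg.linearIndependent p) (hg.isPosOnHor p)
  have hmem : ∀ q v, horPart (g.form q) (k q) (t q) v ∈ horSpace (g.form q) (k q) (t q) :=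
    fun q v => horPart_mem (g.form_symm q) (hg.form_kk_ne_zero (hkt q))
      (hg.form_tt_ne_zero (hkt q)) (hkt q) v
  let x₁ : (q : M) → TangentSpace (𝓡 4) q := fun q => horPart (g.form q) (k q) (t q)
    (FiberBundle.extend (EuclideanSpace ℝ (Fin 4)) x₀ q)
  let y₁ : (q : M) → TangentSpace (𝓡 4) q := fun q => horPart (g.form q) (k q) (t q)
    (FiberBundle.extend (EuclideanSpace ℝ (Fin 4)) y₀ q)
  have hx₁ : SmoothFieldAt x₁ p := smoothFieldAt_horPart hg hkt (smoothFieldAt_extend x₀)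
  have hy₁ : SmoothFieldAt y₁ p := smoothFieldAt_horPart hg hkt (smoothFieldAt_extend y₀)
  have hx₁p : x₁ p = x₀ := by
    simp [x₁, horPart_of_mem (g.form_symm p) h₀.mem_left]
  have hy₁p : y₁ p = y₀ := by
    simp [y₁, horPart_of_mem (g.form_symm p) h₀.mem_right]
  obtain ⟨φ, hφ, hφp, hφ1⟩ := exists_normalize hx₁ (by rw [hx₁p, h₀.norm_left])
  have hx : SmoothFieldAt (φ • x₁) p := hx₁.smul hφ
  have hxp : (φ • x₁) p = x₀ := by simp [hφp, hx₁p]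
  let y₂ : (q : M) → TangentSpace (𝓡 4) q :=
    y₁ - (fun q => g.form q ((φ • x₁) q) (y₁ q)) • (φ • x₁)
  have hy₂ : SmoothFieldAt y₂ p := hy₁.sub (hx.smul (g.smoothFunAt_inner hx hy₁))
  have hy₂p : y₂ p = y₀ := by
    have : y₂ p = y₁ p - g.form p ((φ • x₁) p) (y₁ p) • (φ • x₁) p := rfl
    rw [this, hxp, hy₁p, h₀.ortho]
    simp
  obtain ⟨ψ, hψ, hψp, hψ1⟩ := exists_normalize hy₂ (by rw [hy₂p, h₀.norm_right])
  have hy : SmoothFieldAt (ψ • y₂) p := hy₂.smul hψ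
  have hyp : (ψ • y₂) p = y₀ := by simp [hψp, hy₂p]
  have hor := o.locally_const p ![k, t, φ • x₁, ψ • y₂] (by
      intro i
      fin_cases i
      exacts [k.smoothFieldAt p, t.smoothFieldAt p, hx, hy]) (by
      have : (fun i => (![k, t, φ • x₁, ψ • y₂] : Fin 4 → (q : M) → TangentSpace (𝓡 4) q) i p) =
          ![k p, t p, x₀, y₀] := by
        ext1 i
        fin_cases i
        exacts [rfl, rfl, hxp, hyp]
      rw [this]
      exact h₀.pos)
  refine ⟨φ • x₁, ψ • y₂, hx, hy, ?_⟩
  filter_upwards [hφ1, hψ1, hor] with q hq1 hq2 hq3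
  have hmx : (φ • x₁) q ∈ horSpace (g.form q) (k q) (t q) :=
    Submodule.smul_mem _ _ (hmem q _)
  refine ⟨hmx, Submodule.smul_mem _ _ (Submodule.sub_mem _ (hmem q _)
    (Submodule.smul_mem _ _ hmx)), hq1, hq2, ?_, ?_⟩
  · have : (ψ • y₂) q =
        ψ q • (y₁ q - g.form q ((φ • x₁) q) (y₁ q) • (φ • x₁) q) := rfl
    rw [this, map_smul, map_sub, map_smul, hq1]
    simp
  · convert hq3 using 1
    ext1 i
    fin_cases i <;> rfl

/-- The almost complex structure is smooth and invariant under the flow of `k`. -/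
theorem IsAdmissible.acs_invariant (hg : g.IsAdmissible o k t τ ℓ)
    (hk : IsKillingOn (fun p v w => g.form p v w) k Set.univ)
    (hkt : ∀ p, g.form p (k p) (t p) = 0)
    (hcomm : ∀ p, mlieBracket (𝓡 4) k t p = 0)
    {b : (q : M) → TangentSpace (𝓡 4) q} {p : M} (hb : SmoothFieldAt b p) :
    SmoothFieldAt (fun q => g.acs o k t q (b q)) p ∧
      mlieBracket (𝓡 4) k (fun q => g.acs o k t q (b q)) p =
        g.acs o k t p (mlieBracket (𝓡 4) k b p) := by
  obtain ⟨x, y, hx, hy, hxy⟩ := hg.exists_local_frame hkt p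
  have hks := k.smoothFieldAt p
  have hts := t.smoothFieldAt p
  have hJ : ∀ q, IsAdmissibleEndo (g.form q) (o.toFun q) (k q) (t q) (g.acs o k t q) :=
    fun q => g.isAdmissibleEndo_acs o (hg.linearIndependent q) (hg.isPosOnHor q)
  let c₁ : M → ℝ := fun q => g.form q (b q) (k q) / g.form q (k q) (k q)
  let c₂ : M → ℝ := fun q => g.form q (b q) (t q) / g.form q (t q) (t q)
  let c₃ : M → ℝ := fun q => g.form q (b q) (x q)
  let c₄ : M → ℝ := fun q => g.form q (b q) (y q)
  have h₁ : SmoothFunAt c₁ p := ContMDiffAt.div₀ (g.smoothFunAt_inner hb hks)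
    (g.smoothFunAt_inner hks hks) (hg.form_kk_ne_zero (hkt p))
  have h₂ : SmoothFunAt c₂ p := ContMDiffAt.div₀ (g.smoothFunAt_inner hb hts)
    (g.smoothFunAt_inner hts hts) (hg.form_tt_ne_zero (hkt p))
  have h₃ : SmoothFunAt c₃ p := g.smoothFunAt_inner hb hx
  have h₄ : SmoothFunAt c₄ p := g.smoothFunAt_inner hb hy
  -- `b` and `J b` have the same coefficients `c₁, …, c₄`, attached to `k, t, x, y` and to `J k, J
  -- t, J x, J y` respectively. The derivatives of the coefficients along `k` therefore match under
  -- `J`, and only the brackets of `k` with the frame remain to be compared.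
  have hbe : b =ᶠ[𝓝 p] c₁ • ⇑k + c₂ • ⇑t + c₃ • x + c₄ • y := by
    filter_upwards [hxy] with q hq
    exact hq.expand_full (g.form_symm q) (hg.isPosOnHor q) (hg.form_kk_ne_zero (hkt q))
      (hg.form_tt_ne_zero (hkt q)) (hkt q) (b q)
  have hJe : (fun q => g.acs o k t q (b q)) =ᶠ[𝓝 p]
      c₁ • ⇑t - c₂ • ⇑k + c₃ • y - c₄ • x := by
    filter_upwards [hxy] with q hq
    exact (hJ q).apply_eq (g.form_symm q) (hg.isPosOnHor q) hq (hg.form_kk_ne_zero (hkt q))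
      (hg.form_tt_ne_zero (hkt q)) (hkt q) (b q)
  refine ⟨((((hts.smul h₁).sub (hks.smul h₂)).add (hy.smul h₃)).sub (hx.smul h₄)).congr hJe, ?_⟩
  have hsub : ∀ {U V : (q : M) → TangentSpace (𝓡 4) q}, SmoothFieldAt U p → SmoothFieldAt V p →
      mlieBracket (𝓡 4) k (U - V) p = mlieBracket (𝓡 4) k U p - mlieBracket (𝓡 4) k V p := by
    intro U V hU hV
    have := mlieBracket_add_right (V := k) (hU.sub hV).diff hV.diff
    rw [sub_add_cancel] at this
    rw [this, add_sub_cancel_right]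
  have hsmul : ∀ {c : M → ℝ} {V : (q : M) → TangentSpace (𝓡 4) q}, SmoothFunAt c p →
      SmoothFieldAt V p → mlieBracket (𝓡 4) k (c • V) p =
        dirDeriv c p (k p) • V p + c p • mlieBracket (𝓡 4) k V p :=
    fun hc hV => mlieBracket_smul_right hc.diff hV.diff
  have hp := hxy.self_of_nhds
  have hJp := hJ p
  have hsym := g.form_symm p
  have hpos := hg.isPosOnHor p
  have hJx := hJp.map_left hsym hpos hp
  have hJy := hJp.map_right hsym hpos hp
  have hkx := hg.bracket_k p x hx (hxy.mono fun q hq => hq.mem_left)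
  have hky := hg.bracket_k p y hy (hxy.mono fun q hq => hq.mem_right)
  -- The Killing equation for a pair with constant inner product. Applied to the orthonormal frame
  -- it says that `[k, ·]` is skew on `ℋ`.
  have kill : ∀ {U V : (q : M) → TangentSpace (𝓡 4) q} {c : ℝ}, SmoothFieldAt U p →
      SmoothFieldAt V p → (∀ᶠ q in 𝓝 p, g.form q (U q) (V q) = c) →
      g.form p (mlieBracket (𝓡 4) k U p) (V p) + g.form p (U p) (mlieBracket (𝓡 4) k V p) = 0 := by
    intro U V c hU hV hc
    rw [← hk p trivial U V hU hV, dirDeriv_congr hc, dirDeriv_const]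
  have hxx := kill hx hx (hxy.mono fun q hq => hq.norm_left)
  have hyy := kill hy hy (hxy.mono fun q hq => hq.norm_right)
  have hxy' := kill hx hy (hxy.mono fun q hq => hq.ortho)
  rw [hsym (x p)] at hxx hxy'
  rw [hsym (y p)] at hyy
  have ex := hp.expand hsym hpos hkx
  have ey := hp.expand hsym hpos hky
  -- With `λ = g([k, x], y)` the two expansions become `[k, x] = λ y` and `[k, y] = -λ x`.
  rw [show g.form p (mlieBracket (𝓡 4) k x p) (x p) = 0 by linarith, zero_smul, zero_add] at ex
  rw [show g.form p (mlieBracket (𝓡 4) k y p) (y p) = 0 by linarith,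
    show g.form p (mlieBracket (𝓡 4) k y p) (x p) =
      -g.form p (mlieBracket (𝓡 4) k x p) (y p) by linarith, zero_smul, add_zero] at ey
  have eJ := EventuallyEq.mlieBracket_vectorField_eq (I := 𝓡 4) (EventuallyEq.refl (𝓝 p) ⇑k) hJe
  have eb := EventuallyEq.mlieBracket_vectorField_eq (I := 𝓡 4) (EventuallyEq.refl (𝓝 p) ⇑k) hbe
  rw [eb]
  refine eJ.trans ?_
  rw [hsub (((hts.smul h₁).sub (hks.smul h₂)).add (hy.smul h₃)) (hx.smul h₄),
    mlieBracket_add_right ((hts.smul h₁).sub (hks.smul h₂)).diff (hy.smul h₃).diff,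
    hsub (hts.smul h₁) (hks.smul h₂),
    mlieBracket_add_right (((hks.smul h₁).add (hts.smul h₂)).add (hx.smul h₃)).diff
      (hy.smul h₄).diff,
    mlieBracket_add_right ((hks.smul h₁).add (hts.smul h₂)).diff (hx.smul h₃).diff,
    mlieBracket_add_right (hks.smul h₁).diff (hts.smul h₂).diff,
    hsmul h₁ hts, hsmul h₁ hks, hsmul h₂ hts, hsmul h₂ hks, hsmul h₃ hx, hsmul h₃ hy,
    hsmul h₄ hx, hsmul h₄ hy, hcomm, mlieBracket_self, ex, ey]
  simp only [map_add, map_smul, hJx, hJy, hJp.map_k, hJp.map_t, Pi.zero_apply, map_zero]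
  module

end SemiRiemannianMetric

end KillingField

/-! ### Composition with `τ` and the conclusion -/

theorem smoothFunAt_comp_of_range {M : Type*} [TopologicalSpace M]
    [ChartedSpace (EuclideanSpace ℝ (Fin 4)) M] [IsManifold (𝓡 4) ∞ M]
    (τ : ContMDiffMap (𝓡 4) 𝓘(ℝ, ℝ) M ℝ ∞) {f : ℝ → ℝ} (hf : ContDiffOn ℝ ∞ f (Set.range τ))
    (p : M) : SmoothFunAt (fun q => f (τ q)) p :=
  -- The range of `τ` need not be open, so `f` is smooth only within it; as `τ` maps all of `M` into
  -- its range, the composite is smooth within `Set.univ`.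
  ((hf _ ⟨p, rfl⟩).contMDiffWithinAt.comp p (τ.contMDiff p).contMDiffWithinAt
    (fun q _ => Set.mem_range_self q) : ContMDiffWithinAt _ _ _ _ Set.univ p).contMDiffAt
    Filter.univ_mem

theorem dirDeriv_comp_of_range {M : Type*} [TopologicalSpace M]
    [ChartedSpace (EuclideanSpace ℝ (Fin 4)) M] [IsManifold (𝓡 4) ∞ M]
    (τ : ContMDiffMap (𝓡 4) 𝓘(ℝ, ℝ) M ℝ ∞) {f : ℝ → ℝ} (hf : ContDiffOn ℝ ∞ f (Set.range τ))
    {p : M} {v : TangentSpace (𝓡 4) p} (hv : dirDeriv τ p v = 0) :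
    dirDeriv (fun q => f (τ q)) p v = 0 := by
  -- The derivative of `f` within the range need not be unique, but any choice serves: it is only
  -- evaluated at `dτ(v) = 0`.
  have h1 : HasMFDerivWithinAt 𝓘(ℝ, ℝ) 𝓘(ℝ, ℝ) f (Set.range τ) (τ p) _ :=
    ((hf.differentiableOn (by simp)) _ ⟨p, rfl⟩).hasFDerivWithinAt.hasMFDerivWithinAt
  have h2 : HasMFDerivAt (𝓡 4) 𝓘(ℝ, ℝ) τ p _ := τ.mdifferentiableAt.hasMFDerivAt
  have h3 := (h1.comp p h2.hasMFDerivWithinAt (s := Set.univ)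
    (fun q _ => Set.mem_range_self q)).hasMFDerivAt Filter.univ_mem
  have hv' : mfderiv (𝓡 4) 𝓘(ℝ, ℝ) τ p v = 0 := hv
  change mfderiv (𝓡 4) 𝓘(ℝ, ℝ) (f ∘ τ) p v = 0
  rw [h3.mfderiv]
  change fderivWithin ℝ f (Set.range τ) (τ p) (mfderiv (𝓡 4) 𝓘(ℝ, ℝ) τ p v) = 0
  rw [hv']
  exact map_zero _

theorem mainTheorem11 {M : Type*} [TopologicalSpace M] [T2Space M] [SecondCountableTopology M]
    [ChartedSpace (EuclideanSpace ℝ (Fin 4)) M] [IsManifold (𝓡 4) ∞ M]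
    (g : SemiRiemannianMetric M) (o : ManifoldOrientation M)
    (k t : SmoothVectorField M) (τ ℓ : ContMDiffMap (𝓡 4) 𝓘(ℝ, ℝ) M ℝ ∞)
    (hg : g.IsAdmissible o k t τ ℓ)
    (hk : IsKillingOn (fun p v w => g.form p v w) k Set.univ)
    (hℓ : IsLocallyFunctionOf ℓ τ)
    (hι : IsLocallyFunctionOf (g.twist o k t) τ)
    (hkt : ∀ p, g.form p (k p) (t p) = 0)
    (hcomm : ∀ p, VectorField.mlieBracket (𝓡 4) k t p = 0)
    (f : ℝ → ℝ) (hf : ContDiffOn ℝ ∞ f (Set.range τ)) :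
    IsKillingOn (g.kahlerTensor o k t τ f) k (g.kahlerRegion o k t τ ℓ f) := by
  intro p _ a b ha hb
  have hφ := smoothFunAt_comp_of_range τ hf
  have hinv := g.isInvariantForm_smul_flat hk hφ
    (fun p => dirDeriv_comp_of_range τ hf (hg.dirDeriv_tau (hkt p)))
  obtain ⟨hJb, hkJb⟩ := hg.acs_invariant hk hkt hcomm hb
  -- Invariance of `dα` is applied to `a` and `J b`; then `[k, J b] = J [k, b]` gives the Killing
  -- equation for `dα(·, J·)`.
  have h := hinv.exteriorDeriv (g.isSmoothForm_smul_flat hφ) ha hJb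
  rw [hkJb] at h
  exact h
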